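/- Let $\lambda$ be a rate function on $[0,\infty)$ that is nonnegative and locally integrable, and let $\Delta\ge 0$. Consider the $M_t/D/\infty$ queue that starts empty at time $0$: customers arrive according to a nonhomogeneous Poisson process $N$ on $[0,\infty)$ with rate $\lambda$ (so $N$ is a counting process with nondecreasing, right-continuous paths, $N(0)=0$, independent increments, and $N(t)-N(s)\sim\mathrm{Poisson}\left(\int_s^t\lambda(u)\,du\right)$ for $0\le s\le t$), the $j$-th customer arrives at time $A_j=\inf\{s\ge 0 : N(s)\ge j\}$, and there are infinitely many servers. All service times, namely $S_j$ of the $j$-th customer and $\mathcal S$ of a tagged customer who arrives at time $t$, are independent of each other and of $N$, and have the deterministic distribution concentrated at $\Delta$. For $t\ge 0$ let $$O(t)=\bigl(N(t+\mathcal S)-N(t)\bigr)+\sum_{j=1}^{N(t)}\mathbf 1\{A_j<t<A_j+S_j\}$$ be the number of customers that the tagged customer arriving at time $t$ overlaps with: those arriving during its service plus those present upon its arrival. Then for every $t\ge 0$ $$O(t)\stackrel{D}{=}\mathrm{Poisson}\left(\int_{(t-\Delta)^+}^{t+\Delta}\lambda(u)\,du\right),$$ where $x^+=\max(x,0)$.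 -/

import Mathlib

open MeasureTheory ProbabilityTheory Filter Topology
open scoped NNReal ENNReal

/-- `N` is a (nonhomogeneous) Poisson process on `[0, ∞)` with time-varying rate function `rate`:
a counting process started at `0`, with nondecreasing and right-continuous sample paths,
independent increments, and Poisson distributed increments whose means are the integrals of the
rate. -/
structure IsPoissonProcess {Ω : Type*} [MeasurableSpace Ω] (P : Measure Ω) (rate : ℝ → ℝ)
    (N : ℝ≥0 → Ω → ℕ) : Prop where
  measurable : ∀ s, Measurable (N s)
  start_zero : ∀ᵐ ω ∂P, N 0 ω = 0
  monotone_paths : ∀ᵐ ω ∂P, Monotone fun s => N s ω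
  rightContinuous_paths :
    ∀ᵐ ω ∂P, ∀ s, ContinuousWithinAt (fun r => N r ω) (Set.Ici s) s
  indep_increments : HasIndepIncrements N P
  law_increments : ∀ s t : ℝ≥0, s ≤ t →
    HasLaw (fun ω => N t ω - N s ω)
      (poissonMeasure (∫ u in (s : ℝ)..(t : ℝ), rate u).toNNReal) P

/-- The `M_t/G/∞` queue started empty at time `0`, together with one tagged customer:
customers arrive according to a Poisson process `N` with rate function `rate`; the `j`-th arriving
customer (`j = 1, 2, …`) has service time `S j`, and the tagged customer has service time `T`;
all service times have law `G`, and they are independent of each other and of the arrival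
process. (The entry `S 0` belongs to no customer.) -/
structure IsMtGInftyQueue {Ω : Type*} [MeasurableSpace Ω] (P : Measure Ω) (rate : ℝ → ℝ)
    (G : Measure ℝ≥0) (N : ℝ≥0 → Ω → ℕ) (S : ℕ → Ω → ℝ≥0) (T : Ω → ℝ≥0) : Prop where
  arrivals : IsPoissonProcess P rate N
  measurable_service : ∀ j, Measurable (S j)
  measurable_tagged : Measurable T
  law_service : ∀ j, HasLaw (S j) G P
  law_tagged : HasLaw T G P
  indep_services : iIndepFun S P
  indep_services_arrivals : IndepFun (fun ω j => S j ω) (fun ω s => N s ω) P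
  indep_tagged : IndepFun T (fun ω => ((fun j => S j ω), (fun s => N s ω))) P

/-- The `M_t/D/∞` queue: all service times have the deterministic law at `Δ`. -/
def IsMtDInftyQueue {Ω : Type*} [MeasurableSpace Ω] (P : Measure Ω) (rate : ℝ → ℝ)
    (Δ : ℝ≥0) (N : ℝ≥0 → Ω → ℕ) (S : ℕ → Ω → ℝ≥0) (T : Ω → ℝ≥0) : Prop :=
  IsMtGInftyQueue P rate (Measure.dirac Δ) N S T

/-- The arrival time `A_j` of the `j`-th customer: the first time at which the counting process
reaches `j` (a junk value if it never does; such `j` are never used below). -/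
noncomputable def arrivalTime {Ω : Type*} (N : ℝ≥0 → Ω → ℕ) (j : ℕ) (ω : Ω) : ℝ≥0 :=
  sInf {s : ℝ≥0 | j ≤ N s ω}

open Classical in
/-- The number `Q(t)` of customers `j = 1, …, N(t)` in the system at time `t`, that is, with
`A_j < t < A_j + S_j`. -/
noncomputable def queueLength {Ω : Type*} (N : ℝ≥0 → Ω → ℕ) (S : ℕ → Ω → ℝ≥0) (t : ℝ≥0)
    (ω : Ω) : ℕ :=
  ∑ j ∈ Finset.Icc 1 (N t ω),
    if arrivalTime N j ω < t ∧ t < arrivalTime N j ω + S j ω then 1 else 0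

/-- The number `O(t)` of customers overlapped by a tagged customer arriving at time `t` with
service time `T`: the customers that arrive during the service `(t, t + T]` plus the customers
present at time `t`. -/
noncomputable def overlapCount {Ω : Type*} (N : ℝ≥0 → Ω → ℕ) (S : ℕ → Ω → ℝ≥0) (T : Ω → ℝ≥0)
    (t : ℝ≥0) (ω : Ω) : ℕ :=
  (N (t + T ω) ω - N t ω) + queueLength N S t ω

/-! With all services equal to `Δ`, an earlier customer is still present at `t` exactly when it
arrived in `(t - Δ, t)`. Almost surely no arrival occurs at `t` itself, so the queue length is `N t
- N (t - Δ)`. Adding the arrivals in `(t, t + Δ]` telescopes to the single increment `N (t + Δ) - N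
(t - Δ)`, whose law is Poisson by definition of the process. What carries this is the duality `A_j ≤
s ↔ j ≤ N s` (`arrivalTime_le_iff`) and the absence of a jump at a fixed time
(`IsPoissonProcess.ae_exists_lt_eq`). -/

/-- For a monotone right-continuous counting path, the `j`-th arrival time is at most `s` exactly
when the path has reached `j` by time `s`. -/
theorem arrivalTime_le_iff {Ω : Type*} {N : ℝ≥0 → Ω → ℕ} {ω : Ω}
    (hmono : Monotone fun s => N s ω)
    (hcont : ∀ s, ContinuousWithinAt (fun r => N r ω) (Set.Ici s) s)
    {j : ℕ} {t : ℝ≥0} (ht : j ≤ N t ω) (s : ℝ≥0) :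
    arrivalTime N j ω ≤ s ↔ j ≤ N s ω := by
  refine ⟨fun h => ?_, fun h => csInf_le (OrderBot.bddBelow _) h⟩
  suffices j ≤ N (arrivalTime N j ω) ω from this.trans (hmono h)
  have hne : {s : ℝ≥0 | j ≤ N s ω}.Nonempty := ⟨t, ht⟩
  -- Since `ℕ` is discrete, right continuity makes the path constant just to the right of the
  -- infimum, where points of the set accumulate; hence the infimum is attained.
  have hev : ∀ᶠ r in 𝓝[≥] (arrivalTime N j ω), N r ω = N (arrivalTime N j ω) ω :=
    (hcont (arrivalTime N j ω)).eventually (IsOpen.mem_nhds (isOpen_discrete {_}) rfl)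
  have hfreq : ∃ᶠ r in 𝓝[≥] (arrivalTime N j ω), j ≤ N r ω :=
    (isGLB_csInf hne (OrderBot.bddBelow _)).frequently_mem hne
  obtain ⟨r, hr, hr'⟩ := (hfreq.and_eventually hev).exists
  exact hr' ▸ hr

/-- A function that is locally integrable on `[0, ∞)` is interval integrable between nonnegative times. -/
theorem intervalIntegrable_of_locallyIntegrableOn_Ici {rate : ℝ → ℝ}
    (h : LocallyIntegrableOn rate (Set.Ici 0)) {a b : ℝ} (ha : 0 ≤ a) (hb : 0 ≤ b) :
    IntervalIntegrable rate volume a b := by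
  rw [intervalIntegrable_iff']
  refine h.integrableOn_compact_subset (fun x hx => ?_) isCompact_uIcc
  exact (le_min ha hb).trans hx.1

/-- A Poisson process with locally integrable rate almost surely does not jump at a fixed positive
time. -/
theorem IsPoissonProcess.ae_exists_lt_eq {Ω : Type*} [MeasurableSpace Ω] {P : Measure Ω}
    {rate : ℝ → ℝ} {N : ℝ≥0 → Ω → ℕ} (hN : IsPoissonProcess P rate N)
    (hrate : LocallyIntegrableOn rate (Set.Ici 0)) {t : ℝ≥0} (ht : 0 < t) :
    ∀ᵐ ω ∂P, ∃ s < t, N t ω = N s ω := by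
  -- A jump at `t` forces a nonzero increment over `(s, t]` for each `s < t`; the bound is the
  -- probability of that, and it vanishes as `s ↑ t`.
  have hle (s : ℝ≥0) (hs : s < t) : P {ω | ¬ ∃ s < t, N t ω = N s ω} ≤
      1 - ENNReal.ofReal (Real.exp (-(∫ u in (s : ℝ)..(t : ℝ), rate u).toNNReal)) := by
    have hlaw := hN.law_increments s t hs.le
    have hmeas : MeasurableSet ({0}ᶜ : Set ℕ) := .of_discrete
    calc P {ω | ¬ ∃ s < t, N t ω = N s ω}
        ≤ P ((fun ω => N t ω - N s ω) ⁻¹' {0}ᶜ) := by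
          refine measure_mono_ae ?_
          filter_upwards [hN.monotone_paths] with ω hω h
          intro h0
          exact h ⟨s, hs, le_antisymm (Nat.sub_eq_zero_iff_le.1 h0) (hω hs.le)⟩
      _ = poissonMeasure (∫ u in (s : ℝ)..(t : ℝ), rate u).toNNReal {0}ᶜ := by
          rw [← hlaw.map_eq, Measure.map_apply_of_aemeasurable hlaw.aemeasurable hmeas]
      _ = _ := by
          rw [prob_compl_eq_one_sub (.of_discrete), poissonMeasure_singleton]
          simp
  have hlim : Tendsto (fun s : ℝ≥0 => 1 - ENNReal.ofReal
      (Real.exp (-(∫ u in (s : ℝ)..(t : ℝ), rate u).toNNReal))) (𝓝[<] t) (𝓝 0) := by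
    have hint : Tendsto (fun s : ℝ≥0 => ∫ u in (s : ℝ)..(t : ℝ), rate u) (𝓝[<] t) (𝓝 0) := by
      have hprim : ContinuousOn (fun x : ℝ => ∫ u in (t : ℝ)..x, rate u)
          (Set.uIcc 0 (t : ℝ)) := by
        refine intervalIntegral.continuousOn_primitive_interval' ?_ Set.right_mem_uIcc
        exact intervalIntegrable_of_locallyIntegrableOn_Ici hrate le_rfl t.2
      have hto : Tendsto (fun s : ℝ≥0 => (s : ℝ)) (𝓝[<] t) (𝓝[Set.uIcc 0 (t : ℝ)] t) := by
        refine tendsto_nhdsWithin_iff.2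
          ⟨NNReal.continuous_coe.continuousAt.tendsto.mono_left nhdsWithin_le_nhds, ?_⟩
        filter_upwards [self_mem_nhdsWithin] with s hs
        exact Set.mem_uIcc_of_le s.2 (NNReal.coe_le_coe.2 (le_of_lt hs))
      have := ((hprim t Set.right_mem_uIcc).tendsto.comp hto).neg
      simpa [Function.comp_def, ← intervalIntegral.integral_symm] using this
    have hcont : Continuous fun x : ℝ => 1 - ENNReal.ofReal (Real.exp (-(x.toNNReal : ℝ))) := by
      have : Continuous fun x : ℝ => ENNReal.ofReal (Real.exp (-(x.toNNReal : ℝ))) :=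
        ENNReal.continuous_ofReal.comp (by fun_prop)
      exact (ENNReal.continuous_sub_left ENNReal.one_ne_top).comp this
    simpa [Function.comp_def] using (hcont.tendsto 0).comp hint
  have hne : (𝓝[<] t).NeBot := nhdsLT_neBot_of_exists_lt ⟨0, ht⟩
  rw [ae_iff]
  refine le_antisymm (ge_of_tendsto hlim ?_) zero_le
  filter_upwards [self_mem_nhdsWithin] with s hs using hle s hs

/-- On a monotone right-continuous path that starts at `0` and does not jump at `t`, deterministic
service times `Δ` turn the queue length into an increment of the arrival process. -/
theorem queueLength_eq_sub {Ω : Type*} {N : ℝ≥0 → Ω → ℕ} {S : ℕ → Ω → ℝ≥0} {ω : Ω} {Δ t : ℝ≥0}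
    (hzero : N 0 ω = 0) (hmono : Monotone fun s => N s ω)
    (hcont : ∀ s, ContinuousWithinAt (fun r => N r ω) (Set.Ici s) s)
    (hjump : 0 < t → ∃ s < t, N t ω = N s ω) (hS : ∀ j, S j ω = Δ) :
    queueLength N S t ω = N t ω - N (t - Δ) ω := by
  classical
  have hset : (Finset.Icc 1 (N t ω)).filter
      (fun j => arrivalTime N j ω < t ∧ t < arrivalTime N j ω + S j ω) =
      Finset.Ioc (N (t - Δ) ω) (N t ω) := by
    ext j
    simp only [Finset.mem_filter, Finset.mem_Icc, Finset.mem_Ioc, hS]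
    constructor
    · rintro ⟨⟨hpos, hj⟩, -, hlt⟩
      refine ⟨?_, hj⟩
      by_contra! hle
      by_cases hΔ : Δ ≤ t
      · have := (arrivalTime_le_iff hmono hcont hj (t - Δ)).2 hle
        exact hlt.not_ge ((le_tsub_iff_right hΔ).1 this)
      -- If `t < Δ`, truncation gives `t - Δ = 0`, where the path is `0`, contradicting `1 ≤ j`.
      · rw [tsub_eq_zero_of_le (not_le.1 hΔ).le, hzero] at hle
        omega
    · rintro ⟨hlt, hj⟩
      have ht : 0 < t := by
        refine pos_iff_ne_zero.2 fun h => ?_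
        rw [h, hzero] at hj
        omega
      obtain ⟨s, hs, hst⟩ := hjump ht
      refine ⟨⟨by omega, hj⟩, ?_, ?_⟩
      -- The strict inequality `A_j < t` needs the absence of a jump: level `j` is already reached
      -- at some `s < t`.
      · exact ((arrivalTime_le_iff hmono hcont hj s).2 (hst ▸ hj)).trans_lt hs
      · have h : t - Δ < arrivalTime N j ω := by
          rw [← not_le, arrivalTime_le_iff hmono hcont hj]
          omega
        exact lt_add_of_tsub_lt_right h
  rw [queueLength, ← Nat.card_Ioc, ← hset, Finset.card_filter]

theorem mainTheorem10 {Ω : Type*} [MeasurableSpace Ω] (P : Measure Ω) [IsProbabilityMeasure P]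
    (rate : ℝ → ℝ) (rate_nonneg : ∀ u, 0 ≤ u → 0 ≤ rate u)
    (rate_integrable : LocallyIntegrableOn rate (Set.Ici 0))
    (Δ : ℝ≥0) (N : ℝ≥0 → Ω → ℕ) (S : ℕ → Ω → ℝ≥0) (T : Ω → ℝ≥0)
    (hqueue : IsMtDInftyQueue P rate Δ N S T) (t : ℝ≥0) :
    HasLaw (overlapCount N S T t)
      (poissonMeasure
        (∫ u in (max ((t : ℝ) - (Δ : ℝ)) 0)..((t : ℝ) + (Δ : ℝ)), rate u).toNNReal) P := by
  have hN := hqueue.arrivals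
  have hjump : ∀ᵐ ω ∂P, 0 < t → ∃ s < t, N t ω = N s ω := by
    by_cases ht : 0 < t
    · filter_upwards [hN.ae_exists_lt_eq rate_integrable ht] with ω hω _ using hω
    · exact .of_forall fun ω h => absurd h ht
  have hlaw := hN.law_increments (t - Δ) (t + Δ) (tsub_le_self.trans le_self_add)
  -- Truncated subtraction in `ℝ≥0` is what produces the lower limit `max (t - Δ) 0`.
  rw [NNReal.coe_sub_def, NNReal.coe_add] at hlaw
  refine hlaw.congr ?_
  filter_upwards [hN.start_zero, hN.monotone_paths, hN.rightContinuous_paths, hjump,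
    hqueue.law_tagged.ae_eq_of_dirac,
    ae_all_iff.2 fun j => (hqueue.law_service j).ae_eq_of_dirac]
    with ω hzero hmono hcont hjump hT hS
  rw [overlapCount, queueLength_eq_sub hzero hmono hcont hjump hS, hT]
  -- Monotonicity ensures that neither subtraction in `ℕ` truncates, so the sum telescopes.
  have h1 : N (t - Δ) ω ≤ N t ω := hmono tsub_le_self
  have h2 : N t ω ≤ N (t + Δ) ω := hmono le_self_add
  omega
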